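/- Let $1\le k\le n$ be integers and $\mathfrak g=\mathfrak{gl}(n,\mathbb C)$, identified with $\mathfrak g^*$ by the trace pairing $\langle A,\xi\rangle=\operatorname{Tr}(A\xi)$. For $A\in\mathfrak g$ let $\mathcal O_A=\{gAg^{-1}: g\in GL(n,\mathbb C)\}$ be its (co)adjoint orbit, with tangent space $T_B\mathcal O_A=\{[\xi,B]:\xi\in\mathfrak g\}$ and Kirillov–Kostant–Souriau symplectic form $\omega_B([\xi,B],[\eta,B])=\operatorname{Tr}(B[\xi,\eta])$. Let $p_1,\dots,p_k\in\mathfrak g$ be projectors ($p_i^2=p_i$) of rank $1$ and let $P\in\mathfrak g$ be a projector ($P^2=P$) of rank $k$. Put $Y=\mathcal O_{p_1}\times\dots\times\mathcal O_{p_k}$, equip $Y\times\mathcal O_{-P}$ with the sum of the pullbacks of the symplectic forms of its factors, and let $X=\mu^{-1}(0)$ be the zero fiber of the moment map $$\mu:Y\times\mathcal O_{-P}\to\mathfrak g^*\cong\mathfrak g,\qquad \mu(q_1,\dots,q_k,-Q)=q_1+\dots+q_k-Q,$$ of the diagonal conjugation action of $GL(n,\mathbb C)$. Then $$X=\Bigl\{\bigl(q_1,\dots,q_k,-\textstyle\sum_i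 q_i\bigr): q_i^2=q_i,\ \operatorname{rank} q_i=1,\ q_iq_j=0\ \text{for } i\ne j\Bigr\},$$ and $X$ is a nonempty smooth closed Lagrangian subvariety of $Y\times\mathcal O_{-P}$. That is, $X$ is a Zariski closed set of tuples of matrices contained in $Y\times\mathcal O_{-P}$, and at each of its points it is a complex submanifold whose tangent space is isotropic for the symplectic form of $Y\times\mathcal O_{-P}$ and has half the dimension of the tangent space of $Y\times\mathcal O_{-P}$. -/

import Mathlib

attribute [local instance] Matrix.normedAddCommGroup Matrix.normedSpace

noncomputable section

namespace CoadjointOrbits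

/-- The Lie algebra `gl(n) = gl(n, ℂ)`. It is identified with its dual by the invariant pairing
`⟨A, ξ⟩ = Tr (A ξ)`; under this identification the coadjoint action of `GL(n)` is conjugation. -/
abbrev Gl (n : ℕ) : Type := Matrix (Fin n) (Fin n) ℂ

/-- The coadjoint orbit `O_A = {g A g⁻¹ | g ∈ GL(n)}`. -/
def orbit {n : ℕ} (A : Gl n) : Set (Gl n) :=
  {B | ∃ g : GL (Fin n) ℂ, B = (g : Gl n) * A * ((g⁻¹ : GL (Fin n) ℂ) : Gl n)}

/-- The derivative `ξ ↦ ξ A - A ξ` at `1` of the orbit map `g ↦ g A g⁻¹`. -/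
def infAction {n : ℕ} (A : Gl n) : Gl n →ₗ[ℂ] Gl n where
  toFun ξ := ξ * A - A * ξ
  map_add' ξ η := by rw [add_mul, mul_add]; abel
  map_smul' c ξ := by simp [smul_sub]

/-- The tangent space at `A` of the orbit through `A`: all `[ξ, A]` with `ξ ∈ gl(n)`. -/
def orbitTangent {n : ℕ} (A : Gl n) : Submodule ℂ (Gl n) := LinearMap.range (infAction A)

/-- Value of the Kirillov-Kostant-Souriau form at `A`: for `v = [ξ, A]` and `w = [η, A]` it is
`⟨A, [ξ, η]⟩ = Tr (A (ξ η - η ξ))`; see `kksFun_eq` for independence of the choices. -/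
def kksFun {n : ℕ} (A : Gl n) (v w : orbitTangent A) : ℂ :=
  Matrix.trace (A * (v.2.choose * w.2.choose - w.2.choose * v.2.choose))

theorem trace_eq {n : ℕ} (A ξ η : Gl n) :
    Matrix.trace (A * (ξ * η - η * ξ)) = Matrix.trace (ξ * infAction A η) := by
  simp only [infAction, LinearMap.coe_mk, AddHom.coe_mk, mul_sub, Matrix.trace_sub]
  rw [Matrix.trace_mul_comm A (ξ * η), Matrix.trace_mul_comm A (η * ξ), mul_assoc, mul_assoc,
    Matrix.trace_mul_comm η (ξ * A), mul_assoc, Matrix.trace_mul_comm ξ (η * A), mul_assoc,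
    Matrix.trace_mul_comm η (A * ξ), Matrix.trace_mul_comm ξ (A * η), mul_assoc,
    Matrix.trace_mul_comm A (ξ * η), mul_assoc, mul_assoc, Matrix.trace_mul_comm A (η * ξ),
    mul_assoc]

theorem trace_eq' {n : ℕ} (A ξ η : Gl n) :
    Matrix.trace (A * (ξ * η - η * ξ)) = - Matrix.trace (η * infAction A ξ) := by
  rw [← trace_eq, ← Matrix.trace_neg, ← mul_neg, neg_sub]

theorem kksFun_eq {n : ℕ} (A ξ η : Gl n) (v w : orbitTangent A)
    (hv : infAction A ξ = v) (hw : infAction A η = w) :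
    kksFun A v w = Matrix.trace (A * (ξ * η - η * ξ)) := by
  unfold kksFun
  rw [trace_eq, w.2.choose_spec, ← hw, ← trace_eq, trace_eq', v.2.choose_spec, ← hv, ← trace_eq']

/-- The Kirillov-Kostant-Souriau form at `A`, a bilinear form on the tangent space of the orbit. -/
def kks {n : ℕ} (A : Gl n) : LinearMap.BilinForm ℂ (orbitTangent A) :=
  LinearMap.mk₂ ℂ (kksFun A)
    (by
      rintro ⟨_, ξ, rfl⟩ ⟨_, ξ', rfl⟩ ⟨_, η, rfl⟩
      rw [kksFun_eq A (ξ + ξ') η _ _ (map_add _ _ _) rfl, kksFun_eq A ξ η _ _ rfl rfl,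
        kksFun_eq A ξ' η _ _ rfl rfl]
      rw [trace_eq, trace_eq, trace_eq]
      rw [add_mul, Matrix.trace_add])
    (by
      rintro c ⟨_, ξ, rfl⟩ ⟨_, η, rfl⟩
      rw [kksFun_eq A (c • ξ) η _ _ (map_smul _ _ _) rfl, kksFun_eq A ξ η _ _ rfl rfl]
      rw [trace_eq, trace_eq]
      rw [smul_mul_assoc, Matrix.trace_smul])
    (by
      rintro ⟨_, ξ, rfl⟩ ⟨_, η, rfl⟩ ⟨_, η', rfl⟩
      rw [kksFun_eq A ξ (η + η') _ _ rfl (map_add _ _ _), kksFun_eq A ξ η _ _ rfl rfl,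
        kksFun_eq A ξ η' _ _ rfl rfl]
      rw [trace_eq, trace_eq, trace_eq]
      rw [map_add, mul_add, Matrix.trace_add])
    (by
      rintro c ⟨_, ξ, rfl⟩ ⟨_, η, rfl⟩
      rw [kksFun_eq A ξ (c • η) _ _ rfl (map_smul _ _ _), kksFun_eq A ξ η _ _ rfl rfl]
      rw [trace_eq, trace_eq]
      rw [map_smul, mul_smul_comm, Matrix.trace_smul])

theorem kks_eq {n : ℕ} (A ξ η : Gl n) (v w : orbitTangent A)
    (hv : infAction A ξ = v) (hw : infAction A η = w) :
    kks A v w = Matrix.trace (A * (ξ * η - η * ξ)) :=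
  kksFun_eq A ξ η v w hv hw

/-- The Kirillov-Kostant-Souriau form is nondegenerate. -/
theorem kks_nondegenerate {n : ℕ} (A : Gl n) (w : orbitTangent A)
    (h : ∀ v, kks A v w = 0) : w = 0 := by
  obtain ⟨_, η, rfl⟩ := w
  have h1 : infAction A η = 0 := by
    refine Matrix.ext_iff_trace_mul_left.mpr fun ξ => ?_
    have := h ⟨infAction A ξ, ξ, rfl⟩
    rw [kks_eq A ξ η _ _ rfl rfl, trace_eq] at this
    simpa using this
  exact Subtype.ext h1

/-- The product of the coadjoint orbits of the matrices `A a`. -/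
def orbitProd {n : ℕ} {ι : Type} (A : ι → Gl n) : Set (ι → Gl n) :=
  {x | ∀ a, x a ∈ orbit (A a)}

/-- The tangent space at `x` of the product of the orbits through the components of `x`. -/
def prodTangent {n : ℕ} {ι : Type} (x : ι → Gl n) : Submodule ℂ (ι → Gl n) :=
  Submodule.pi Set.univ fun a => orbitTangent (x a)

/-- The symplectic form of a product of coadjoint orbits: the sum of the pullbacks of the
Kirillov-Kostant-Souriau forms of the factors. -/
def prodForm {n : ℕ} {ι : Type} [Fintype ι] (x : ι → Gl n) (v w : prodTangent x) : ℂ :=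
  ∑ a, kks (x a) ⟨v.1 a, v.2 a trivial⟩ ⟨w.1 a, w.2 a trivial⟩

/-- The moment map of the diagonal conjugation action of `GL(n)` on a product of orbits. -/
def momentMap {n : ℕ} {ι : Type} [Fintype ι] (x : ι → Gl n) : Gl n := ∑ a, x a

/-- The defining property of a moment map: contracting the symplectic form with the vector field
`x ↦ ([ξ, x a])ₐ` generated by `ξ` gives the differential of `x ↦ ⟨momentMap x, ξ⟩`. -/
theorem momentMap_spec {n : ℕ} {ι : Type} [Fintype ι] (x : ι → Gl n) (ξ : Gl n)
    (w : prodTangent x) :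
    prodForm x ⟨fun a => infAction (x a) ξ, fun _ _ => ⟨ξ, rfl⟩⟩ w =
      Matrix.trace (momentMap w.1 * ξ) := by
  unfold prodForm momentMap
  rw [Finset.sum_mul, Matrix.trace_sum]
  refine Finset.sum_congr rfl fun a _ => ?_
  obtain ⟨η, hη⟩ := w.2 a trivial
  rw [kks_eq (x a) ξ η _ _ rfl hη, trace_eq, hη, Matrix.trace_mul_comm]

/-- Zariski closed subsets of the affine space of families of matrices: the common zero sets of
families of polynomials in the matrix entries. -/
def IsZariskiClosed {n : ℕ} {ι : Type} (X : Set (ι → Gl n)) : Prop :=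
  ∃ S : Set (MvPolynomial (ι × Fin n × Fin n) ℂ),
    X = {x | ∀ f ∈ S, MvPolynomial.eval (fun c => x c.1 c.2.1 c.2.2) f = 0}

/-- Near its point `x`, the set `X` is a complex submanifold of `E` with tangent space `T`: in a
neighbourhood of `x` it is the zero set of a holomorphic map whose differential at `x` is
surjective with kernel `T`. -/
def IsSubmanifoldAt {E : Type} [NormedAddCommGroup E] [NormedSpace ℂ E]
    (X : Set E) (x : E) (T : Submodule ℂ E) : Prop :=
  x ∈ X ∧ ∃ (c : ℕ) (U : Set E) (F : E → Fin c → ℂ),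
    IsOpen U ∧ x ∈ U ∧ DifferentiableOn ℂ F U ∧
    X ∩ U = {y ∈ U | F y = 0} ∧
    Function.Surjective (fderiv ℂ F x) ∧
    T = LinearMap.ker (fderiv ℂ F x : E →ₗ[ℂ] Fin c → ℂ)

/-- `T` is a Lagrangian subspace of the tangent space at `x` of the product of the orbits through
the components of `x`: it is isotropic and of half dimension. -/
def IsLagrangianSubspace {n : ℕ} {ι : Type} [Fintype ι] (x : ι → Gl n)
    (T : Submodule ℂ (ι → Gl n)) : Prop :=
  ∃ hT : T ≤ prodTangent x,
    (∀ (v w : ι → Gl n) (hv : v ∈ T) (hw : w ∈ T), prodForm x ⟨v, hT hv⟩ ⟨w, hT hw⟩ = 0) ∧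
    2 * Module.finrank ℂ T = Module.finrank ℂ (prodTangent x)

/-- `X` is a smooth closed Lagrangian subvariety of the product of the coadjoint orbits of the
matrices `A a`: a Zariski closed set contained in the product of the orbits which at each of its
points is a complex submanifold with Lagrangian tangent space. -/
structure IsLagrangianSubvariety {n : ℕ} {ι : Type} [Fintype ι] (A : ι → Gl n)
    (X : Set (ι → Gl n)) : Prop where
  subset : X ⊆ orbitProd A
  closed : IsZariskiClosed X
  lagrangian : ∀ x ∈ X, ∃ T, IsSubmanifoldAt X x T ∧ IsLagrangianSubspace x T

/-- The matrices `p 1, …, p k, -P`, indexed by `Option (Fin k)`: the component `some i` is `p i`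
and the component `none` is `-P`. -/
def withNeg {n k : ℕ} (p : Fin k → Gl n) (P : Gl n) : Option (Fin k) → Gl n
  | some i => p i
  | none => -P

/-- The fibre over `0` of the moment map on a product of coadjoint orbits. -/
def zeroFiber {n : ℕ} {ι : Type} [Fintype ι] (A : ι → Gl n) : Set (ι → Gl n) :=
  {x ∈ orbitProd A | momentMap x = 0}

/-- Systems of `k` pairwise orthogonal projectors of rank `1`, together with minus their sum. -/
def orthogonalSystems (n k : ℕ) : Set (Option (Fin k) → Gl n) :=
  {x | ∃ q : Fin k → Gl n, (∀ i, q i * q i = q i ∧ (q i).rank = 1) ∧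
    (∀ i j, i ≠ j → q i * q j = 0) ∧ x = withNeg q (∑ i, q i)}

end CoadjointOrbits

end

noncomputable section

namespace CoadjointOrbits

/-! The orbit of an idempotent consists of all idempotents of the same rank, so a point of the zero
fibre is a family of rank one idempotents `q i` whose sum `Q` is idempotent of rank `k`. Writing `Q
= A * B` with inner size `k`, with columns and rows taken from the `q i`, idempotency and maximal
rank force `B * A = 1`; its off-diagonal entries give orthogonality
(`mul_eq_zero_of_sum_idempotent`).

The tangent space of the fibre at `x` is the space of all `([ξ, x a])ₐ`. By the moment map identity,
its symplectic orthogonal is the kernel of the differential of the moment map. It is isotropic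
because the moment map vanishes at `x`, and Lagrangian once that kernel is no larger
(`isLagrangianSubspace_range_diagAction`). Linearizing the orthogonality relations gives the
required `ξ` explicitly (`diagAction_sliceMap`).

Smoothness comes from a holomorphic local retraction. With `g y = ∑ i, y i * q i + (1 - ∑ i, y i) *
(1 - Q)`, the map `y ↦ g y * x * (g y)⁻¹` lands in the fibre by conjugation invariance, and fixes
its points because `g y` intertwines `x` and `y` (`mul_slice`). The fibre is then a submanifold by
`isSubmanifoldAt_of_retraction`. -/

/-! ### Idempotents and their conjugacy classes -/

/-- An idempotent matrix of rank `r` factors as `A * B` with `B * A = 1`. -/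
theorem exists_factorization_of_idempotent {n r : ℕ} {e : Gl n} (he : e * e = e)
    (hr : e.rank = r) :
    ∃ (A : Matrix (Fin n) (Fin r) ℂ) (B : Matrix (Fin r) (Fin n) ℂ), A * B = e ∧ B * A = 1 := by
  set f := Matrix.toLin' e with hf
  have hff : ∀ v, f (f v) = f v := fun v => by
    rw [← LinearMap.comp_apply, hf, ← Matrix.toLin'_mul, he]
  have hfin : Module.finrank ℂ (LinearMap.range f) = r := by
    rw [← hr, Matrix.rank, hf, Matrix.toLin'_apply']
  let b := Module.finBasisOfFinrankEq ℂ _ hfin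
  refine ⟨LinearMap.toMatrix' ((LinearMap.range f).subtype ∘ₗ b.equivFun.symm.toLinearMap),
    LinearMap.toMatrix' (b.equivFun.toLinearMap ∘ₗ f.rangeRestrict), ?_, ?_⟩
  · rw [← LinearMap.toMatrix'_comp]
    have : ((LinearMap.range f).subtype ∘ₗ b.equivFun.symm.toLinearMap) ∘ₗ
        (b.equivFun.toLinearMap ∘ₗ f.rangeRestrict) = f := by
      ext1; ext1; simp
    rw [this, hf, LinearMap.toMatrix'_toLin']
  · rw [← LinearMap.toMatrix'_comp, ← LinearMap.toMatrix'_id]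
    congr 1
    refine LinearMap.ext fun v => ?_
    have h1 : ∀ w : LinearMap.range f, f.rangeRestrict (w : Fin n → ℂ) = w := by
      rintro ⟨_, u, rfl⟩
      exact Subtype.ext (hff u)
    simp only [LinearMap.comp_apply, Submodule.subtype_apply, h1, LinearEquiv.coe_coe,
      LinearEquiv.apply_symm_apply, LinearMap.id_apply]

/-- Cyclicity of the trace turns `A * B` into an identity matrix of size the rank. This makes rank
additive on orthogonal sums and expressible by a polynomial equation. -/
theorem trace_eq_rank_of_idempotent {n : ℕ} {e : Gl n} (he : e * e = e) :
    e.trace = (e.rank : ℂ) := by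
  obtain ⟨A, B, hAB, hBA⟩ := exists_factorization_of_idempotent he rfl
  rw [← hAB, Matrix.trace_mul_comm, hBA, Matrix.trace_one, Fintype.card_fin, hAB]

theorem one_sub_mul_one_sub {n : ℕ} {e : Gl n} (he : e * e = e) : (1 - e) * (1 - e) = 1 - e := by
  rw [mul_sub, sub_mul, sub_mul, he]; simp

theorem rank_one_sub_eq {n : ℕ} {e f : Gl n} (he : e * e = e) (hf : f * f = f)
    (h : e.rank = f.rank) : (1 - e).rank = (1 - f).rank := by
  have h1 := trace_eq_rank_of_idempotent (one_sub_mul_one_sub he)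
  have h2 := trace_eq_rank_of_idempotent (one_sub_mul_one_sub hf)
  rw [Matrix.trace_sub, trace_eq_rank_of_idempotent he] at h1
  rw [Matrix.trace_sub, trace_eq_rank_of_idempotent hf, ← h, h1] at h2
  exact_mod_cast h2

theorem mul_eq_zero_of_idempotent_factors {n r s : ℕ} {e : Gl n} (he : e * e = e)
    {A : Matrix (Fin n) (Fin r) ℂ} {B : Matrix (Fin r) (Fin n) ℂ}
    {C : Matrix (Fin n) (Fin s) ℂ} {D : Matrix (Fin s) (Fin n) ℂ}
    (hAB : A * B = e) (hBA : B * A = 1) (hCD : C * D = 1 - e) (hDC : D * C = 1) :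
    B * C = 0 := by
  have h : B * C = B * ((A * B) * (C * D)) * C := by
    calc B * C = (B * A) * (B * C) * (D * C) := by rw [hBA, hDC]; simp
      _ = _ := by simp only [Matrix.mul_assoc]
  rw [h, hAB, hCD, mul_sub, mul_one, he, sub_self]
  simp

/-- Idempotent matrices of the same rank are conjugate. -/
theorem mem_orbit_of_idempotent {n : ℕ} {e f : Gl n} (he : e * e = e) (hf : f * f = f)
    (h : f.rank = e.rank) : f ∈ orbit e := by
  obtain ⟨A, B, hAB, hBA⟩ := exists_factorization_of_idempotent he rfl
  obtain ⟨A', B', hAB', hBA'⟩ := exists_factorization_of_idempotent hf h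
  obtain ⟨C, D, hCD, hDC⟩ := exists_factorization_of_idempotent (one_sub_mul_one_sub he) rfl
  obtain ⟨C', D', hCD', hDC'⟩ :=
    exists_factorization_of_idempotent (one_sub_mul_one_sub hf) (rank_one_sub_eq hf he h)
  have hBC := mul_eq_zero_of_idempotent_factors he hAB hBA hCD hDC
  have hDA := mul_eq_zero_of_idempotent_factors (one_sub_mul_one_sub he) hCD hDC
    (by rw [sub_sub_cancel]; exact hAB) hBA
  -- The conjugating matrix carries the image and kernel of `e` to those of `f`; the cross terms
  -- vanish since `B * C = 0` and `D * A = 0`.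
  have hgh : (A' * B + C' * D) * (A * B' + C * D') = 1 := by
    calc (A' * B + C' * D) * (A * B' + C * D')
        = A' * (B * A) * B' + A' * (B * C) * D' + C' * (D * A) * B' + C' * (D * C) * D' := by
          simp only [Matrix.mul_assoc, Matrix.mul_add, Matrix.add_mul]; abel
      _ = 1 := by
          rw [hBA, hBC, hDA, hDC]
          simp [hAB', hCD']
  let g : GL (Fin n) ℂ := ⟨A' * B + C' * D, A * B' + C * D', hgh, mul_eq_one_comm.mp hgh⟩
  refine ⟨g, ?_⟩
  change f = (A' * B + C' * D) * e * (A * B' + C * D')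
  calc f = A' * (B * A) * (B * A) * B' + A' * (B * A) * (B * C) * D' +
        C' * (D * A) * (B * A) * B' + C' * (D * A) * (B * C) * D' := by
        rw [hBA, hBC, hDA]; simp [hAB']
    _ = (A' * B + C' * D) * (A * B) * (A * B' + C * D') := by
        simp only [Matrix.mul_assoc, Matrix.mul_add, Matrix.add_mul]; abel
    _ = _ := by rw [hAB]

theorem conj_mem_orbit {n : ℕ} {A B : Gl n} (hB : B ∈ orbit A) (g : GL (Fin n) ℂ) :
    (g : Gl n) * B * ((g⁻¹ : GL (Fin n) ℂ) : Gl n) ∈ orbit A := by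
  obtain ⟨h, rfl⟩ := hB
  exact ⟨g * h, by rw [mul_inv_rev]; push_cast; simp only [mul_assoc]⟩

theorem mem_orbit_iff_of_idempotent {n : ℕ} {e f : Gl n} (he : e * e = e) :
    f ∈ orbit e ↔ f * f = f ∧ f.rank = e.rank := by
  refine ⟨?_, fun h => mem_orbit_of_idempotent he h.1 h.2⟩
  rintro ⟨g, rfl⟩
  have hf : (g : Gl n) * e * ((g⁻¹ : GL (Fin n) ℂ) : Gl n) *
      ((g : Gl n) * e * ((g⁻¹ : GL (Fin n) ℂ) : Gl n)) =
      (g : Gl n) * e * ((g⁻¹ : GL (Fin n) ℂ) : Gl n) := by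
    simp only [mul_assoc, Units.inv_mul_cancel_left]
    rw [← mul_assoc e e, he]
  refine ⟨hf, ?_⟩
  have h := trace_eq_rank_of_idempotent hf
  rw [Matrix.trace_mul_comm, Units.inv_mul_cancel_left, trace_eq_rank_of_idempotent he] at h
  exact_mod_cast h.symm

theorem neg_mem_orbit_neg_iff {n : ℕ} {A B : Gl n} : -B ∈ orbit (-A) ↔ B ∈ orbit A := by
  simp only [orbit, Set.mem_ofPred_eq, mul_neg, neg_mul, neg_inj]

/-! ### The zero fibre consists of orthogonal systems -/

/-- Rank one idempotents whose sum is an idempotent of maximal rank are orthogonal. -/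
theorem mul_eq_zero_of_sum_idempotent {n k : ℕ} {q : Fin k → Gl n}
    (hq : ∀ i, q i * q i = q i) (hq1 : ∀ i, (q i).rank = 1)
    (hQ : (∑ i, q i) * (∑ i, q i) = ∑ i, q i) (hQk : (∑ i, q i).rank = k)
    {i j : Fin k} (hij : i ≠ j) : q i * q j = 0 := by
  choose a b hab hba using fun i => exists_factorization_of_idempotent (hq i) (hq1 i)
  let A : Matrix (Fin n) (Fin k) ℂ := Matrix.of fun s i => a i s 0
  let B : Matrix (Fin k) (Fin n) ℂ := Matrix.of fun i t => b i 0 t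
  have hAB : A * B = ∑ i, q i := by
    ext s t
    rw [Matrix.sum_apply, Matrix.mul_apply]
    refine Finset.sum_congr rfl fun i _ => ?_
    rw [← hab i, Matrix.mul_apply]
    simp [A, B]
  obtain ⟨C, D, hCD, hDC⟩ := exists_factorization_of_idempotent hQ hQk
  -- `D * A` and `B * C` are square of size `k`, so this one-sided identity makes them mutually
  -- inverse. In `h2`, `Q * Q = Q` inserts `B * A` between them without changing the product, whence
  -- `B * A = 1`.
  have h1 : (D * A) * (B * C) = 1 := by
    calc (D * A) * (B * C) = D * (A * B) * C := by simp only [Matrix.mul_assoc]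
      _ = (D * C) * (D * C) := by rw [hAB, ← hCD]; simp only [Matrix.mul_assoc]
      _ = 1 := by rw [hDC, mul_one]
  have h2 : (D * A) * (B * A) * (B * C) = 1 := by
    calc (D * A) * (B * A) * (B * C) = D * ((A * B) * (A * B)) * C := by
          simp only [Matrix.mul_assoc]
      _ = (D * C) * (D * C) := by rw [hAB, hQ, ← hCD]; simp only [Matrix.mul_assoc]
      _ = 1 := by rw [hDC, mul_one]
  have h3 : (B * C) * (D * A) = 1 := mul_eq_one_comm.mp h1
  have hBA : B * A = 1 := by
    calc B * A = ((B * C) * (D * A)) * (B * A) * ((B * C) * (D * A)) := by rw [h3]; simp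
      _ = (B * C) * ((D * A) * (B * A) * (B * C)) * (D * A) := by simp only [Matrix.mul_assoc]
      _ = 1 := by rw [h2, mul_one, h3]
  have hz : b i * a j = 0 := by
    have h := congrFun (congrFun hBA i) j
    rw [Matrix.one_apply_ne hij, Matrix.mul_apply] at h
    ext s t
    rw [Subsingleton.elim s 0, Subsingleton.elim t 0, Matrix.mul_apply]
    exact h
  calc q i * q j = a i * (b i * a j) * b j := by
        rw [← hab i, ← hab j]; simp only [Matrix.mul_assoc]
    _ = 0 := by rw [hz]; simp

theorem sum_mul_self_of_orthogonal {n k : ℕ} {q : Fin k → Gl n}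
    (hq : ∀ i, q i * q i = q i) (ho : ∀ i j, i ≠ j → q i * q j = 0) (j : Fin k) :
    (∑ i, q i) * q j = q j := by
  rw [Finset.sum_mul, Finset.sum_eq_single j (fun i _ h => ho i j h) (by simp), hq]

theorem self_mul_sum_of_orthogonal {n k : ℕ} {q : Fin k → Gl n}
    (hq : ∀ i, q i * q i = q i) (ho : ∀ i j, i ≠ j → q i * q j = 0) (j : Fin k) :
    q j * (∑ i, q i) = q j := by
  rw [Finset.mul_sum, Finset.sum_eq_single j (fun i _ h => ho j i h.symm) (by simp), hq]

theorem sum_idempotent_of_orthogonal {n k : ℕ} {q : Fin k → Gl n}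
    (hq : ∀ i, q i * q i = q i) (ho : ∀ i j, i ≠ j → q i * q j = 0) :
    (∑ i, q i) * (∑ i, q i) = ∑ i, q i := by
  rw [Finset.mul_sum]
  exact Finset.sum_congr rfl fun j _ => sum_mul_self_of_orthogonal hq ho j

theorem rank_sum_of_orthogonal {n k : ℕ} {q : Fin k → Gl n}
    (hq : ∀ i, q i * q i = q i) (hq1 : ∀ i, (q i).rank = 1)
    (ho : ∀ i j, i ≠ j → q i * q j = 0) : (∑ i, q i).rank = k := by
  have h := trace_eq_rank_of_idempotent (sum_idempotent_of_orthogonal hq ho)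
  simp only [Matrix.trace_sum, trace_eq_rank_of_idempotent (hq _), hq1] at h
  simp only [Nat.cast_one, Finset.sum_const, Finset.card_univ, Fintype.card_fin, nsmul_eq_mul,
    mul_one] at h
  exact_mod_cast h.symm

theorem momentMap_option {n k : ℕ} (x : Option (Fin k) → Gl n) :
    momentMap x = x none + ∑ i, x (some i) :=
  Fintype.sum_option x

theorem zeroFiber_eq_orthogonalSystems {n k : ℕ} {p : Fin k → Gl n} {P : Gl n}
    (hp : ∀ i, p i * p i = p i) (hp1 : ∀ i, (p i).rank = 1)
    (hP : P * P = P) (hPk : P.rank = k) :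
    zeroFiber (withNeg p P) = orthogonalSystems n k := by
  ext x
  constructor
  · rintro ⟨hx, hm⟩
    have h1 : ∀ i, x (some i) * x (some i) = x (some i) ∧ (x (some i)).rank = 1 := fun i => by
      have h := (mem_orbit_iff_of_idempotent (hp i)).mp (hx (some i))
      rwa [hp1 i] at h
    have hn : x none = -∑ i, x (some i) := by
      rw [momentMap_option] at hm
      exact eq_neg_of_add_eq_zero_left hm
    have h2 : -∑ i, x (some i) ∈ orbit (-P) := hn ▸ hx none
    rw [neg_mem_orbit_neg_iff, mem_orbit_iff_of_idempotent hP, hPk] at h2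
    refine ⟨fun i => x (some i), h1, fun i j hij => mul_eq_zero_of_sum_idempotent
      (fun i => (h1 i).1) (fun i => (h1 i).2) h2.1 h2.2 hij, ?_⟩
    funext a
    cases a with
    | none => exact hn
    | some i => rfl
  · rintro ⟨q, hq, ho, rfl⟩
    refine ⟨?_, ?_⟩
    · rintro (_ | i)
      · exact neg_mem_orbit_neg_iff.mpr ((mem_orbit_iff_of_idempotent hP).mpr
          ⟨sum_idempotent_of_orthogonal (fun i => (hq i).1) ho, by
            rw [hPk, rank_sum_of_orthogonal (fun i => (hq i).1) (fun i => (hq i).2) ho]⟩)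
      · exact (mem_orbit_iff_of_idempotent (hp i)).mpr ⟨(hq i).1, (hq i).2.trans (hp1 i).symm⟩
    · rw [momentMap_option]
      exact neg_add_cancel _

theorem orthogonalSystems_nonempty {n k : ℕ} (hkn : k ≤ n) : (orthogonalSystems n k).Nonempty := by
  let q : Fin k → Gl n := fun i => Matrix.single (Fin.castLE hkn i) (Fin.castLE hkn i) 1
  have hq : ∀ i, q i * q i = q i := fun i => by simp [q]
  refine ⟨_, q, fun i => ⟨hq i, ?_⟩, fun i j hij => ?_, rfl⟩
  · have h := trace_eq_rank_of_idempotent (hq i)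
    rw [Matrix.trace_single_eq_same] at h
    exact_mod_cast h.symm
  · exact Matrix.single_mul_single_of_ne _ _ _ _ (fun h => hij (Fin.castLE_injective hkn h)) _

/-! ### Polynomial equations for the fibre -/

theorem isZariskiClosed_orthogonalSystems (n k : ℕ) :
    IsZariskiClosed (orthogonalSystems n k) := by
  let Y : Option (Fin k) → Matrix (Fin n) (Fin n) (MvPolynomial (Option (Fin k) × Fin n × Fin n) ℂ) :=
    fun a => Matrix.of fun s t => MvPolynomial.X (a, s, t)
  -- For an idempotent, rank one is the same as trace one, so no minors are needed.
  refine ⟨{f | (∃ i s t, f = (Y (some i) * Y (some i) - Y (some i)) s t) ∨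
    (∃ i, f = (Y (some i)).trace - 1) ∨
    (∃ i j s t, i ≠ j ∧ f = (Y (some i) * Y (some j)) s t) ∨
    (∃ s t, f = (Y none + ∑ i, Y (some i)) s t)}, ?_⟩
  ext x
  have hmul : ∀ a b s t, MvPolynomial.eval (fun c => x c.1 c.2.1 c.2.2) ((Y a * Y b) s t) =
      (x a * x b) s t := by
    intro a b s t
    simp [Matrix.mul_apply, Y]
  have hY : ∀ a s t, MvPolynomial.eval (fun c => x c.1 c.2.1 c.2.2) (Y a s t) = x a s t := by
    intro a s t
    simp [Y]
  constructor
  · rintro ⟨q, hq, ho, rfl⟩ f (⟨i, s, t, rfl⟩ | ⟨i, rfl⟩ | ⟨i, j, s, t, hij, rfl⟩ | ⟨s, t, rfl⟩)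
    · rw [Matrix.sub_apply, map_sub, hmul, hY, sub_eq_zero]
      exact congrFun (congrFun (hq i).1 s) t
    · have h : (q i).trace = 1 := by rw [trace_eq_rank_of_idempotent (hq i).1, (hq i).2, Nat.cast_one]
      simp only [map_sub, Matrix.trace, Matrix.diag_apply, map_sum, hY, map_one, sub_eq_zero]
      exact h
    · rw [hmul]
      exact congrFun (congrFun (ho i j hij) s) t
    · rw [Matrix.add_apply, Matrix.sum_apply, map_add, map_sum]
      simp only [hY]
      change (-∑ i, q i) s t + ∑ i, q i s t = 0
      rw [Matrix.neg_apply, Matrix.sum_apply, neg_add_cancel]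
  · intro h
    have hq : ∀ i, x (some i) * x (some i) = x (some i) := fun i => by
      ext s t
      have := h _ (Or.inl ⟨i, s, t, rfl⟩)
      rwa [Matrix.sub_apply, map_sub, hmul, hY, sub_eq_zero] at this
    refine ⟨fun i => x (some i), fun i => ⟨hq i, ?_⟩, fun i j hij => ?_, ?_⟩
    · have := h _ (Or.inr (Or.inl ⟨i, rfl⟩))
      simp only [map_sub, Matrix.trace, Matrix.diag_apply, map_sum, hY, map_one,
        sub_eq_zero] at this
      have h2 := trace_eq_rank_of_idempotent (hq i)
      rw [show (x (some i)).trace = 1 from this] at h2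
      exact_mod_cast h2.symm
    · ext s t
      have := h _ (Or.inr (Or.inr (Or.inl ⟨i, j, s, t, hij, rfl⟩)))
      rwa [hmul] at this
    · funext a
      cases a with
      | some i => rfl
      | none =>
        refine eq_neg_of_add_eq_zero_left ?_
        ext s t
        have := h _ (Or.inr (Or.inr (Or.inr ⟨s, t, rfl⟩)))
        rw [Matrix.add_apply, Matrix.sum_apply, map_add, map_sum] at this
        simpa only [hY, Matrix.add_apply, Matrix.sum_apply, Matrix.zero_apply] using this

/-! ### Symplectic linear algebra on the zero fibre -/

theorem infAction_apply {n : ℕ} (A ξ : Gl n) : infAction A ξ = ξ * A - A * ξ := rfl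

/-- The tangent vectors `([ξ, x a])ₐ` of the diagonal conjugation action at `x`. -/
def diagAction {n : ℕ} {ι : Type} (x : ι → Gl n) : Gl n →ₗ[ℂ] (ι → Gl n) :=
  LinearMap.pi fun a => infAction (x a)

theorem range_diagAction_le {n : ℕ} {ι : Type} (x : ι → Gl n) :
    LinearMap.range (diagAction x) ≤ prodTangent x := by
  rintro _ ⟨ξ, rfl⟩ a _
  exact ⟨ξ, rfl⟩

theorem momentMap_diagAction {n : ℕ} {ι : Type} [Fintype ι] (x : ι → Gl n) (ξ : Gl n) :
    momentMap (diagAction x ξ) = infAction (momentMap x) ξ := by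
  simp only [momentMap, infAction_apply, diagAction, LinearMap.pi_apply, Finset.sum_sub_distrib,
    Finset.mul_sum, Finset.sum_mul]

/-- The projection from the tangent space of the product to the tangent space of a factor. -/
def prodTangentProj {n : ℕ} {ι : Type} (x : ι → Gl n) (a : ι) :
    prodTangent x →ₗ[ℂ] orbitTangent (x a) :=
  LinearMap.codRestrict _ (LinearMap.proj a ∘ₗ (prodTangent x).subtype) fun v => v.2 a trivial

/-- The symplectic form of a product of coadjoint orbits as a bilinear form. -/
def prodBilin {n : ℕ} {ι : Type} [Fintype ι] (x : ι → Gl n) :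
    LinearMap.BilinForm ℂ (prodTangent x) :=
  ∑ a, (kks (x a)).compl₁₂ (prodTangentProj x a) (prodTangentProj x a)

theorem prodBilin_apply {n : ℕ} {ι : Type} [Fintype ι] (x : ι → Gl n) (v w : prodTangent x) :
    prodBilin x v w = prodForm x v w := by
  simp only [prodBilin, prodForm, LinearMap.sum_apply, LinearMap.compl₁₂_apply]
  rfl

theorem kks_swap {n : ℕ} (A : Gl n) (v w : orbitTangent A) : kks A v w = -kks A w v := by
  obtain ⟨_, ξ, rfl⟩ := v
  obtain ⟨_, η, rfl⟩ := w
  rw [kks_eq A ξ η _ _ rfl rfl, kks_eq A η ξ _ _ rfl rfl, trace_eq, trace_eq', neg_neg]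

theorem prodForm_nondegenerate {n : ℕ} {ι : Type} [Fintype ι] (x : ι → Gl n)
    (w : prodTangent x) (h : ∀ v, prodForm x v w = 0) : w = 0 := by
  classical
  refine Subtype.ext (funext fun a => ?_)
  have h1 : (⟨w.1 a, w.2 a trivial⟩ : orbitTangent (x a)) = 0 := by
    refine kks_nondegenerate _ _ fun v => ?_
    have hv : Pi.single a v.1 ∈ prodTangent x := by
      intro b _
      by_cases hb : b = a
      · subst hb; rw [Pi.single_eq_same]; exact v.2
      · rw [Pi.single_eq_of_ne hb]; exact zero_mem _
    have h2 := h ⟨_, hv⟩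
    rw [prodForm, Finset.sum_eq_single a] at h2
    · simpa only [Pi.single_eq_same] using h2
    · intro b _ hb
      simp only [Pi.single_eq_of_ne hb]
      exact LinearMap.map_zero₂ _ _
    · simp
  exact congrArg Subtype.val h1

/-- The moment map identity reduces the pairing to the trace of `[η, momentMap x] * ξ`, which is
zero on the zero fibre. -/
theorem prodForm_diagAction_eq_zero {n : ℕ} {ι : Type} [Fintype ι] {x : ι → Gl n}
    (hx : momentMap x = 0) (ξ : Gl n) (w : prodTangent x)
    (hw : w.1 ∈ LinearMap.range (diagAction x)) :
    prodForm x ⟨diagAction x ξ, range_diagAction_le x ⟨ξ, rfl⟩⟩ w = 0 := by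
  obtain ⟨η, hη⟩ := hw
  refine (momentMap_spec x ξ w).trans ?_
  rw [← hη, momentMap_diagAction, hx, infAction_apply]
  simp

/-- On the zero fibre of the moment map, the tangent space of the orbit of the diagonal action is
Lagrangian as soon as it is the whole kernel of the differential of the moment map. -/
theorem isLagrangianSubspace_range_diagAction {n : ℕ} {ι : Type} [Fintype ι] {x : ι → Gl n}
    (hx : momentMap x = 0)
    (h : ∀ w ∈ prodTangent x, momentMap w = 0 → w ∈ LinearMap.range (diagAction x)) :
    IsLagrangianSubspace x (LinearMap.range (diagAction x)) := by
  refine ⟨range_diagAction_le x, ?_, ?_⟩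
  · rintro _ w ⟨ξ, rfl⟩ hw
    exact prodForm_diagAction_eq_zero hx ξ ⟨w, range_diagAction_le x hw⟩ hw
  · set W := (LinearMap.range (diagAction x)).comap (prodTangent x).subtype with hW
    have hWr : Module.finrank ℂ W = Module.finrank ℂ (LinearMap.range (diagAction x)) :=
      (Submodule.comapSubtypeEquivOfLe (range_diagAction_le x)).finrank_eq
    -- By `momentMap_spec` and nondegeneracy of the trace pairing, a vector orthogonal to `W` is
    -- killed by the differential of the moment map, so `h` puts it back in `W`.
    have horth : (prodBilin x).orthogonal W = W := by
      ext w
      rw [LinearMap.BilinForm.mem_orthogonal_iff]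
      constructor
      · intro hw
        refine h w.1 w.2 (Matrix.ext_iff_trace_mul_right.mpr fun ξ => ?_)
        have h1 := hw ⟨diagAction x ξ, range_diagAction_le x ⟨ξ, rfl⟩⟩ ⟨ξ, rfl⟩
        rw [prodBilin_apply] at h1
        rw [zero_mul, Matrix.trace_zero, ← momentMap_spec]
        exact h1
      · rintro hw ⟨_, hv⟩ ⟨ξ, rfl⟩
        rw [prodBilin_apply]
        exact prodForm_diagAction_eq_zero hx ξ w hw
    have hker : (prodBilin x).ker = ⊥ := by
      refine LinearMap.ker_eq_bot'.mpr fun w hw => prodForm_nondegenerate x w fun v => ?_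
      have h1 : prodForm x w v = 0 := by rw [← prodBilin_apply, hw]; rfl
      have h2 : prodForm x v w = -prodForm x w v := by
        rw [prodForm, prodForm, ← Finset.sum_neg_distrib]
        exact Finset.sum_congr rfl fun a _ => kks_swap _ _ _
      rw [h2, h1, neg_zero]
    have h3 := LinearMap.BilinForm.finrank_add_finrank_orthogonal' (B := prodBilin x) W
    rw [horth, hker, inf_bot_eq, finrank_bot, add_zero, hWr] at h3
    rw [two_mul]
    exact h3

/-! ### The kernel of the differential of the moment map -/

/-- The linear part of the local slice `y ↦ ∑ₐ yₐ qₐ` to the conjugation action, where `q` is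
completed by `1 - ∑ i, q i` to a complete system. -/
def sliceMap {n k : ℕ} (q : Fin k → Gl n) : (Option (Fin k) → Gl n) →ₗ[ℂ] Gl n where
  toFun w := ∑ i, w (some i) * q i - (∑ i, w (some i)) * (1 - ∑ i, q i)
  map_add' v w := by
    simp only [Pi.add_apply, add_mul, Finset.sum_add_distrib]; abel
  map_smul' c w := by
    simp only [Pi.smul_apply, smul_mul_assoc, ← Finset.smul_sum, RingHom.id_apply, smul_sub]

theorem sliceMap_apply {n k : ℕ} (q : Fin k → Gl n) (w : Option (Fin k) → Gl n) :
    sliceMap q w = ∑ i, w (some i) * q i - (∑ i, w (some i)) * (1 - ∑ i, q i) := rfl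

theorem mul_add_mul_of_mem_orbitTangent {n : ℕ} {e w : Gl n} (he : e * e = e)
    (hw : w ∈ orbitTangent e) : e * w + w * e = w := by
  obtain ⟨η, rfl⟩ := hw
  rw [infAction_apply, mul_sub, sub_mul, ← mul_assoc e e, he, mul_assoc η, he, mul_assoc]
  abel

theorem mul_mul_eq_zero_of_mul_add_mul {n : ℕ} {e w : Gl n} (he : e * e = e)
    (hw : e * w + w * e = w) : e * w * e = 0 := by
  have h := congrArg (fun z => e * z) hw
  simp only [mul_add, ← mul_assoc, he] at h
  exact left_eq_add.mp h.symm

section Orthogonal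

variable {n k : ℕ} {q : Fin k → Gl n}

/-- This is the linearization of `q i * q j = 0`. Sandwiching `hW` between `q i` and `q j` gives `z
+ z = z` for `z = q i * (∑ l, w l) * q j`, so `z = 0`; in this sum only the terms `l = i` and `l =
j` survive. -/
theorem mul_add_mul_eq_zero_of_tangent (hq : ∀ i, q i * q i = q i)
    (ho : ∀ i j, i ≠ j → q i * q j = 0) {w : Fin k → Gl n}
    (hw : ∀ i, q i * w i + w i * q i = w i)
    (hW : (∑ i, q i) * (∑ i, w i) + (∑ i, w i) * (∑ i, q i) = ∑ i, w i)
    {i j : Fin k} (hij : i ≠ j) : q i * w j + w i * q j = 0 := by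
  have h0 : q i * (∑ l, w l) * q j = 0 := by
    have h := congrArg (fun z => q i * z * q j) hW
    have h' : q i * (∑ i, q i) * (∑ l, w l) * q j + q i * (∑ l, w l) * ((∑ i, q i) * q j) =
        q i * (∑ l, w l) * q j := by
      rw [← h]
      simp only [mul_add, add_mul, mul_assoc]
    rw [self_mul_sum_of_orthogonal hq ho, sum_mul_self_of_orthogonal hq ho] at h'
    exact left_eq_add.mp h'.symm
  have h1 : q i * w i * q j = w i * q j := by
    conv_rhs => rw [← hw i]
    rw [add_mul, mul_assoc (w i), ho i j hij, mul_zero, add_zero]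
  have h2 : q i * w j * q j = q i * w j := by
    conv_rhs => rw [← hw j]
    rw [mul_add, ← mul_assoc, ho i j hij, zero_mul, zero_add, mul_assoc]
  have h3 : ∀ l, l ≠ i ∧ l ≠ j → q i * w l * q j = 0 := by
    rintro l ⟨hi, hj⟩
    rw [← hw l, mul_add, add_mul, ← mul_assoc, ho i l hi.symm, zero_mul, zero_mul, zero_add,
      mul_assoc, mul_assoc, ho l j hj, mul_zero, mul_zero]
  rw [Finset.mul_sum, Finset.sum_mul, Fintype.sum_eq_add i j hij h3, h1, h2] at h0
  rw [add_comm, h0]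

/-- Tangent vectors of the product of the orbits killed by the differential of the moment map are
generated by the diagonal action. -/
theorem diagAction_sliceMap (hq : ∀ i, q i * q i = q i) (ho : ∀ i j, i ≠ j → q i * q j = 0)
    {w : Option (Fin k) → Gl n} (hw : w ∈ prodTangent (withNeg q (∑ i, q i)))
    (hm : momentMap w = 0) : diagAction (withNeg q (∑ i, q i)) (sliceMap q w) = w := by
  set Q := ∑ i, q i with hQ
  set u : Fin k → Gl n := fun i => w (some i) with hu
  have hn : w none = -∑ i, u i := by
    rw [momentMap_option] at hm
    exact eq_neg_of_add_eq_zero_left hm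
  have h1 : ∀ i, q i * u i + u i * q i = u i := fun i =>
    mul_add_mul_of_mem_orbitTangent (hq i) (hw (some i) trivial)
  have h2 : Q * (∑ i, u i) + (∑ i, u i) * Q = ∑ i, u i := by
    refine mul_add_mul_of_mem_orbitTangent (sum_idempotent_of_orthogonal hq ho) ?_
    obtain ⟨η, hη⟩ := hw none trivial
    refine ⟨η, ?_⟩
    have h3 : η * -Q - -Q * η = -∑ i, u i := hn ▸ hη
    rw [infAction_apply, ← neg_inj, ← h3]
    simp only [mul_neg, neg_mul]; abel
  have h3 : ∀ i j, i ≠ j → q i * u j = -(u i * q j) := fun i j hij =>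
    eq_neg_of_add_eq_zero_left (mul_add_mul_eq_zero_of_tangent hq ho h1 h2 hij)
  have h4 : ∀ j, q j * u j * q j = 0 := fun j => mul_mul_eq_zero_of_mul_add_mul (hq j) (h1 j)
  have hsum : ∀ j, Q = q j + ∑ i ∈ Finset.univ.erase j, q i := fun j =>
    (Finset.add_sum_erase _ _ (Finset.mem_univ j)).symm
  -- The choice of `ξ` is the derivative of the intertwiner `slice q`: differentiating `y * slice q
  -- y = slice q y * x` along the fibre, where `slice q x = 1`, predicts `[ξ, x] = w`.
  have hj : ∀ j, infAction (q j) (sliceMap q w) = u j := by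
    intro j
    have hr : sliceMap q w * q j = u j * q j := by
      rw [sliceMap_apply, sub_mul, mul_assoc, sub_mul, one_mul,
        sum_mul_self_of_orthogonal hq ho, sub_self, mul_zero, sub_zero, Finset.sum_mul,
        Finset.sum_eq_single j]
      · rw [mul_assoc, hq]
      · intro i _ hi
        rw [mul_assoc, ho i j hi, mul_zero]
      · simp
    have ha : q j * ∑ i, u i * q i = -(u j * (Q - q j)) := by
      rw [Finset.mul_sum, ← Finset.add_sum_erase _ _ (Finset.mem_univ j), ← mul_assoc, h4,
        zero_add, hsum j, add_sub_cancel_left, Finset.mul_sum, ← Finset.sum_neg_distrib]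
      refine Finset.sum_congr rfl fun i hi => ?_
      rw [← mul_assoc, h3 j i (Finset.ne_of_mem_erase hi).symm, neg_mul, mul_assoc, hq]
    have hb : q j * ∑ i, u i = q j * u j - u j * (Q - q j) := by
      rw [Finset.mul_sum, ← Finset.add_sum_erase _ _ (Finset.mem_univ j), hsum j,
        add_sub_cancel_left, Finset.mul_sum, sub_eq_add_neg, ← Finset.sum_neg_distrib]
      congr 1
      exact Finset.sum_congr rfl fun i hi => h3 j i (Finset.ne_of_mem_erase hi).symm
    have hc : (Q - q j) * (1 - Q) = 0 := by
      rw [sub_mul, mul_sub, mul_sub, mul_one, mul_one, sum_idempotent_of_orthogonal hq ho,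
        self_mul_sum_of_orthogonal hq ho, sub_self, sub_self, sub_self]
    have hl : q j * sliceMap q w = -(u j * (Q - q j)) - q j * u j * (1 - Q) := by
      rw [sliceMap_apply, mul_sub, ← mul_assoc (q j), ha, hb, sub_mul, mul_assoc (u j), hc,
        mul_zero, sub_zero]
    have hd : u j * Q = q j * u j * Q + u j * q j := by
      conv_lhs => rw [← h1 j]
      rw [add_mul, mul_assoc (u j), self_mul_sum_of_orthogonal hq ho]
    rw [infAction_apply, hr, hl]
    simp only [mul_sub, mul_one, hd]
    conv_rhs => rw [← h1 j]
    abel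
  funext a
  cases a with
  | some j => exact hj j
  | none =>
    change infAction (-Q) (sliceMap q w) = _
    rw [hn, infAction_apply, ← Finset.sum_congr rfl fun j _ => hj j]
    simp only [infAction_apply, Finset.sum_sub_distrib, ← Finset.mul_sum, ← Finset.sum_mul, ← hQ]
    simp only [mul_neg, neg_mul]; abel

theorem diagAction_sliceMap_diagAction (hq : ∀ i, q i * q i = q i)
    (ho : ∀ i j, i ≠ j → q i * q j = 0) (ξ : Gl n) :
    diagAction (withNeg q (∑ i, q i)) (sliceMap q (diagAction (withNeg q (∑ i, q i)) ξ)) =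
      diagAction (withNeg q (∑ i, q i)) ξ := by
  refine diagAction_sliceMap hq ho (range_diagAction_le _ ⟨ξ, rfl⟩) ?_
  rw [momentMap_diagAction, momentMap_option, infAction_apply]
  simp [withNeg]

end Orthogonal

/-! ### Submanifolds from holomorphic retractions -/

/-- A set which is locally the image of a holomorphic retraction is a complex submanifold. -/
theorem isSubmanifoldAt_of_retraction {E : Type} [NormedAddCommGroup E] [NormedSpace ℂ E]
    [FiniteDimensional ℂ E] {X : Set E} {x : E} {r : E → E} {D : E →L[ℂ] E} {U : Set E}
    (hU : IsOpen U) (hxU : x ∈ U) (hx : x ∈ X) (hr : HasStrictFDerivAt r D x)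
    (hrU : DifferentiableOn ℂ r U) (hrX : ∀ y ∈ U, r y ∈ X) (hfix : ∀ y ∈ U, y ∈ X → r y = y)
    (hD : ∀ v, D (D v) = D v) :
    IsSubmanifoldAt X x (LinearMap.ker (1 - D : E →L[ℂ] E).toLinearMap) := by
  have : CompleteSpace E := FiniteDimensional.complete ℂ E
  set C : E →L[ℂ] E := 1 - D with hC
  have hCC : ∀ v, C (C v) = C v := fun v => by
    simp only [hC, sub_apply, one_apply_eq_self, map_sub, hD]
    abel
  let b := Module.finBasis ℂ (LinearMap.range C.toLinearMap)
  let L : E →L[ℂ] Fin (Module.finrank ℂ (LinearMap.range C.toLinearMap)) → ℂ :=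
    LinearMap.toContinuousLinearMap (b.equivFun.toLinearMap ∘ₗ C.toLinearMap.rangeRestrict)
  have hL : ∀ v, L v = b.equivFun (C.toLinearMap.rangeRestrict v) := fun v => rfl
  have hLsurj : Function.Surjective L :=
    b.equivFun.surjective.comp C.toLinearMap.surjective_rangeRestrict
  have hLz : ∀ v, L v = 0 ↔ C v = 0 := fun v => by
    rw [hL, LinearEquiv.map_eq_zero_iff, ← Subtype.coe_inj]; rfl
  have hLC : L.comp C = L := by
    ext1 v
    rw [ContinuousLinearMap.comp_apply, hL, hL]
    congr 1
    exact Subtype.ext (hCC v)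
  have hid : HasStrictFDerivAt (fun y => y - r y) C x := (hasStrictFDerivAt_id x).sub hr
  -- The derivative is `D * D + C * C = D + C = 1` because `D` and `C` are complementary
  -- projections, so this map is injective near `x`.
  have hΦ : HasStrictFDerivAt (fun y => D (r y) + C (y - r y))
      ((ContinuousLinearEquiv.refl ℂ E : E ≃L[ℂ] E) : E →L[ℂ] E) x := by
    have h := (D.hasStrictFDerivAt.comp x hr).add (C.hasStrictFDerivAt.comp x hid)
    have h' : D.comp D + C.comp C = ((ContinuousLinearEquiv.refl ℂ E : E ≃L[ℂ] E) : E →L[ℂ] E) := by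
      ext1 v
      simp only [add_apply, ContinuousLinearMap.comp_apply, hD, hCC]
      simp [hC]
    exact h' ▸ h
  have hinj := (hΦ.toOpenPartialHomeomorph _).injOn
  rw [hΦ.toOpenPartialHomeomorph_coe] at hinj
  set V := (hΦ.toOpenPartialHomeomorph _).source
  have hV : V ∈ nhds x :=
    (hΦ.toOpenPartialHomeomorph _).open_source.mem_nhds hΦ.mem_toOpenPartialHomeomorph_source
  have hrx : r x = x := hfix x hxU hx
  have htend : Filter.Tendsto r (nhds x) (nhds x) := by
    have h := hr.continuousAt.tendsto
    rwa [hrx] at h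
  -- Both `y` and `r y` must lie where `r` retracts and where the auxiliary map is injective.
  have hev : (U ∩ V) ∩ r ⁻¹' (U ∩ V) ∈ nhds x :=
    Filter.inter_mem (Filter.inter_mem (hU.mem_nhds hxU) hV)
      (htend (Filter.inter_mem (hU.mem_nhds hxU) hV))
  obtain ⟨N, hN, hNo, hxN⟩ := mem_nhds_iff.mp hev
  have hF : HasFDerivAt (fun y => L (y - r y)) L x := by
    have h := (L.hasStrictFDerivAt.comp x hid).hasFDerivAt
    rwa [hLC] at h
  refine ⟨hx, _, N, fun y => L (y - r y), hNo, hxN, ?_, ?_, ?_, ?_⟩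
  · exact L.differentiable.comp_differentiableOn
      (differentiableOn_id.sub (hrU.mono fun y hy => (hN hy).1.1))
  · ext y
    constructor
    · rintro ⟨hyX, hy⟩
      refine ⟨hy, ?_⟩
      change L (y - r y) = 0
      rw [hfix y (hN hy).1.1 hyX, sub_self, map_zero]
    · rintro ⟨hy, hy0⟩
      refine ⟨?_, hy⟩
      obtain ⟨⟨hyU, hyV⟩, hryU, hryV⟩ := hN hy
      have h1 : C (y - r y) = 0 := (hLz _).mp hy0
      have h2 : r (r y) = r y := hfix _ hryU (hrX y hyU)
      -- The auxiliary map takes the value `D (r y)` at both points: at `y` since `C (y - r y) = 0`,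
      -- at `r y` since `r (r y) = r y`.
      have h3 : y = r y := hinj hyV hryV (by simp only [h1, h2, sub_self, map_zero])
      rw [h3]
      exact hrX y hyU
  · rw [hF.fderiv]; exact hLsurj
  · rw [hF.fderiv]
    ext v
    simp only [LinearMap.mem_ker]
    exact (hLz v).symm

/-! ### Derivatives of inversion and conjugation -/

theorem hasStrictFDerivAt_matrix_inv {n : ℕ} {M : Gl n} (hM : IsUnit M) :
    HasStrictFDerivAt (fun N : Gl n => N⁻¹)
      (LinearMap.toContinuousLinearMap (-LinearMap.mulLeftRight ℂ (M⁻¹, M⁻¹))) M := by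
  -- The entrywise sup norm in force on matrices is not submultiplicative, so inversion is
  -- differentiated in the Banach algebra of operators and transported back.
  let e := Matrix.toEuclideanCLM (n := Fin n) (𝕜 := ℂ)
  let m : Gl n →* (EuclideanSpace ℂ (Fin n) →L[ℂ] EuclideanSpace ℂ (Fin n)) :=
    MonoidHomClass.toMonoidHom e
  let c : Gl n ≃L[ℂ] _ := e.toAlgEquiv.toLinearEquiv.toContinuousLinearEquiv
  have hc : ∀ N, c N = e N := fun N => rfl
  have hinv : ∀ N : Gl n, c.symm (Ring.inverse (c N)) = N⁻¹ := fun N => by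
    rw [ContinuousLinearEquiv.symm_apply_eq, hc, hc, Matrix.nonsing_inv_eq_ringInverse]
    by_cases hN : IsUnit N
    · obtain ⟨u, rfl⟩ := hN
      rw [Ring.inverse_unit]
      exact Ring.inverse_unit (Units.map m u)
    · rw [Ring.inverse_non_unit _ hN, Ring.inverse_non_unit, map_zero]
      intro h
      exact hN ((MulEquiv.isUnit_map e).mp h)
  obtain ⟨u, rfl⟩ := hM
  have h1 := hasStrictFDerivAt_ringInverse (𝕜 := ℂ) (Units.map m u)
  have h2 := c.symm.hasStrictFDerivAt.comp (u : Gl n)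
    (HasStrictFDerivAt.comp (u : Gl n) h1 c.hasStrictFDerivAt)
  refine (h2.congr_fderiv ?_).congr_of_eventuallyEq (Filter.Eventually.of_forall hinv)
  ext1 v
  have h3 : ((Units.map m u)⁻¹ : Units _).val = e (u : Gl n)⁻¹ := by
    rw [← Matrix.coe_units_inv]; rfl
  change c.symm (-(((Units.map m u)⁻¹ : Units _).val * c v * ((Units.map m u)⁻¹ : Units _).val)) =
    -((u : Gl n)⁻¹ * v * (u : Gl n)⁻¹)
  rw [h3, ContinuousLinearEquiv.symm_apply_eq, hc, hc, map_neg, map_mul, map_mul]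

theorem HasStrictFDerivAt.matrix_mul {n : ℕ} {E : Type} [NormedAddCommGroup E] [NormedSpace ℂ E]
    {f g : E → Gl n} {f' g' : E →L[ℂ] Gl n} {y : E} (hf : HasStrictFDerivAt f f' y)
    (hg : HasStrictFDerivAt g g' y) :
    ∃ D : E →L[ℂ] Gl n, HasStrictFDerivAt (fun z => f z * g z) D y ∧
      ∀ v, D v = f y * g' v + f' v * g y :=
  ⟨_, (LinearMap.mul ℂ (Gl n)).toContinuousBilinearMap.hasStrictFDerivAt_of_bilinear hf hg,
    fun _ => rfl⟩

theorem hasStrictFDerivAt_conj {n : ℕ} (A : Gl n) {M : Gl n} (hM : IsUnit M) :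
    ∃ D : Gl n →L[ℂ] Gl n, HasStrictFDerivAt (fun N : Gl n => N * A * N⁻¹) D M ∧
      ∀ v, D v = v * A * M⁻¹ - M * A * (M⁻¹ * v * M⁻¹) := by
  obtain ⟨D₁, h₁, hD₁⟩ := HasStrictFDerivAt.matrix_mul (hasStrictFDerivAt_id M)
    (hasStrictFDerivAt_const A M)
  obtain ⟨D, h, hD⟩ := HasStrictFDerivAt.matrix_mul h₁ (hasStrictFDerivAt_matrix_inv hM)
  refine ⟨D, h, fun v => ?_⟩
  refine (hD v).trans ?_
  have h₂ : D₁ v = v * A := (hD₁ v).trans (by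
    change M * 0 + v * A = v * A
    rw [mul_zero, zero_add])
  rw [h₂]
  change M * A * -(M⁻¹ * v * M⁻¹) + v * A * M⁻¹ = _
  rw [mul_neg, neg_add_eq_sub]

theorem conj_mem_zeroFiber {n : ℕ} {ι : Type} [Fintype ι] {A x : ι → Gl n}
    (hx : x ∈ zeroFiber A) {M : Gl n} (hM : IsUnit M) :
    (fun a => M * x a * M⁻¹) ∈ zeroFiber A := by
  obtain ⟨u, rfl⟩ := hM
  refine ⟨fun a => ?_, ?_⟩
  · simpa only [Matrix.coe_units_inv] using conj_mem_orbit (hx.1 a) u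
  · have h : (u : Gl n) * momentMap x * (u : Gl n)⁻¹ = 0 := by rw [hx.2, mul_zero, zero_mul]
    simpa only [momentMap, Finset.mul_sum, Finset.sum_mul] using h

/-! ### The slice retraction onto the fibre -/

/-- The intertwiner `∑ₐ yₐ qₐ`, where `y` and `q` are completed to sum up to `1`. -/
def slice {n k : ℕ} (q : Fin k → Gl n) (y : Option (Fin k) → Gl n) : Gl n :=
  sliceMap q y + (1 - ∑ i, q i)

section Orthogonal

variable {n k : ℕ} {q : Fin k → Gl n}

theorem slice_self (hq : ∀ i, q i * q i = q i) (ho : ∀ i j, i ≠ j → q i * q j = 0) :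
    slice q (withNeg q (∑ i, q i)) = 1 := by
  rw [slice, sliceMap_apply]
  simp only [withNeg, hq, mul_sub, sum_idempotent_of_orthogonal hq ho]
  simp

/-- For the component `some j`, orthogonality of each system collapses both sides to `y (some j) * q
j`; the component `none` follows by summing. -/
theorem mul_slice (ho : ∀ i j, i ≠ j → q i * q j = 0) (hq : ∀ i, q i * q i = q i)
    {y : Option (Fin k) → Gl n} (hy : y ∈ orthogonalSystems n k) (a : Option (Fin k)) :
    y a * slice q y = slice q y * withNeg q (∑ i, q i) a := by
  obtain ⟨s, hs, hso, rfl⟩ := hy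
  have hs1 : ∀ i, s i * s i = s i := fun i => (hs i).1
  have h : ∀ j, s j * slice q (withNeg s (∑ i, s i)) = slice q (withNeg s (∑ i, s i)) * q j := by
    intro j
    have hl : s j * slice q (withNeg s (∑ i, s i)) = s j * q j := by
      rw [slice, sliceMap_apply, mul_add, mul_sub, ← mul_assoc (s j) (∑ i, _)]
      simp only [withNeg]
      rw [self_mul_sum_of_orthogonal hs1 hso, sub_add_cancel, Finset.mul_sum,
        Finset.sum_eq_single j]
      · rw [← mul_assoc, hs1]
      · intro i _ hi
        rw [← mul_assoc, hso j i hi.symm, zero_mul]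
      · simp
    have hr : slice q (withNeg s (∑ i, s i)) * q j = s j * q j := by
      have hz : (1 - ∑ i, q i) * q j = 0 := by
        rw [sub_mul, one_mul, sum_mul_self_of_orthogonal hq ho, sub_self]
      rw [slice, sliceMap_apply, add_mul, sub_mul, mul_assoc _ _ (q j), hz, mul_zero, add_zero,
        sub_zero, Finset.sum_mul]
      simp only [withNeg]
      rw [Finset.sum_eq_single j]
      · rw [mul_assoc, hq]
      · intro i _ hi
        rw [mul_assoc, ho i j hi, mul_zero]
      · simp
    rw [hl, hr]
  cases a with
  | some j => exact h j
  | none =>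
    change -(∑ i, s i) * _ = _ * -(∑ i, q i)
    rw [neg_mul, mul_neg, Finset.sum_mul, Finset.mul_sum]
    exact congrArg _ (Finset.sum_congr rfl fun j _ => h j)

theorem hasStrictFDerivAt_slice (q : Fin k → Gl n) (y : Option (Fin k) → Gl n) :
    HasStrictFDerivAt (slice q) (LinearMap.toContinuousLinearMap (sliceMap q)) y :=
  (LinearMap.toContinuousLinearMap (sliceMap q)).hasStrictFDerivAt.add_const _

theorem hasStrictFDerivAt_sliceRetraction (x : Option (Fin k) → Gl n)
    {y : Option (Fin k) → Gl n} (hy : IsUnit (slice q y)) :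
    ∃ D : (Option (Fin k) → Gl n) →L[ℂ] (Option (Fin k) → Gl n),
      HasStrictFDerivAt (fun z a => slice q z * x a * (slice q z)⁻¹) D y ∧
      ∀ v a, D v a = sliceMap q v * x a * (slice q y)⁻¹ -
        slice q y * x a * ((slice q y)⁻¹ * sliceMap q v * (slice q y)⁻¹) := by
  choose D hD hDv using fun a => hasStrictFDerivAt_conj (x a) hy
  refine ⟨ContinuousLinearMap.pi fun a =>
    (D a).comp (LinearMap.toContinuousLinearMap (sliceMap q)), ?_, fun v a => hDv a _⟩
  exact hasStrictFDerivAt_pi.mpr fun a => (hD a).comp y (hasStrictFDerivAt_slice q y)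

theorem isSubmanifoldAt_zeroFiber {A : Option (Fin k) → Gl n}
    (hA : zeroFiber A = orthogonalSystems n k) (hq : ∀ i, q i * q i = q i)
    (ho : ∀ i j, i ≠ j → q i * q j = 0) (hx : withNeg q (∑ i, q i) ∈ zeroFiber A) :
    IsSubmanifoldAt (zeroFiber A) (withNeg q (∑ i, q i))
      (LinearMap.range (diagAction (withNeg q (∑ i, q i)))) := by
  set x := withNeg q (∑ i, q i) with hxdef
  have hx1 : slice q x = 1 := slice_self hq ho
  obtain ⟨D, hD, hDv⟩ := hasStrictFDerivAt_sliceRetraction (q := q) x (y := x)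
    (hx1 ▸ isUnit_one)
  have hDv' : ∀ v, D v = diagAction x (sliceMap q v) := fun v => by
    funext a
    rw [hDv, hx1]
    simp [diagAction, infAction_apply]
  have hcont : Continuous (slice q) :=
    ((sliceMap q).continuous_of_finiteDimensional).add continuous_const
  have hU : IsOpen {y | IsUnit (slice q y)} := by
    have h : {y | IsUnit (slice q y)} = {y | (slice q y).det ≠ 0} := by
      ext y
      exact (Matrix.isUnit_iff_isUnit_det _).trans isUnit_iff_ne_zero
    rw [h]
    exact isOpen_ne_fun hcont.matrix_det continuous_const
  -- `D` is `diagAction x ∘ sliceMap q`, which is the identity on the range of `diagAction x`; hence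
  -- that range is exactly the fixed space of `D`.
  have hker : LinearMap.range (diagAction x) =
      LinearMap.ker (1 - D : (Option (Fin k) → Gl n) →L[ℂ] _).toLinearMap := by
    ext v
    have h : v ∈ LinearMap.ker (1 - D : (Option (Fin k) → Gl n) →L[ℂ] _).toLinearMap ↔
        v - D v = 0 := Iff.rfl
    rw [h, sub_eq_zero, hDv']
    constructor
    · rintro ⟨ξ, rfl⟩
      exact (diagAction_sliceMap_diagAction hq ho ξ).symm
    · intro h
      exact ⟨_, h.symm⟩
  rw [hker]
  refine isSubmanifoldAt_of_retraction hU (hx1 ▸ isUnit_one : IsUnit (slice q x)) hx hD ?_ ?_ ?_ ?_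
  · intro y hy
    obtain ⟨D', hD', -⟩ := hasStrictFDerivAt_sliceRetraction (q := q) x hy
    exact hD'.hasFDerivAt.differentiableAt.differentiableWithinAt
  · intro y hy
    exact conj_mem_zeroFiber hx hy
  · intro y hy hyX
    funext a
    have hdet : IsUnit (slice q y).det := (Matrix.isUnit_iff_isUnit_det _).mp hy
    rw [← mul_slice ho hq (hA ▸ hyX) a, mul_assoc, Matrix.mul_nonsing_inv _ hdet, mul_one]
  · intro v
    exact (hDv' (D v)).trans ((congrArg (fun w => diagAction x (sliceMap q w)) (hDv' v)).trans
      ((diagAction_sliceMap_diagAction hq ho _).trans (hDv' v).symm))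

end Orthogonal

end CoadjointOrbits

end

theorem mainTheorem6 (n k : ℕ) (hk : 1 ≤ k) (hkn : k ≤ n)
    (p : Fin k → Matrix (Fin n) (Fin n) ℂ) (P : Matrix (Fin n) (Fin n) ℂ)
    (hp : ∀ i, p i * p i = p i) (hp1 : ∀ i, (p i).rank = 1)
    (hP : P * P = P) (hPk : P.rank = k) :
    CoadjointOrbits.zeroFiber (CoadjointOrbits.withNeg p P) =
        CoadjointOrbits.orthogonalSystems n k ∧
      (CoadjointOrbits.zeroFiber (CoadjointOrbits.withNeg p P)).Nonempty ∧
      CoadjointOrbits.IsLagrangianSubvariety (CoadjointOrbits.withNeg p P)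
        (CoadjointOrbits.zeroFiber (CoadjointOrbits.withNeg p P)) := by
  open CoadjointOrbits in
  have hX := zeroFiber_eq_orthogonalSystems hp hp1 hP hPk
  refine ⟨hX, hX ▸ orthogonalSystems_nonempty hkn, fun x hx => hx.1,
    hX ▸ isZariskiClosed_orthogonalSystems n k, fun x hx => ?_⟩
  obtain ⟨q, hq, ho, rfl⟩ := hX ▸ hx
  have hq' : ∀ i, q i * q i = q i := fun i => (hq i).1
  exact ⟨_, isSubmanifoldAt_zeroFiber hX hq' ho hx,
    isLagrangianSubspace_range_diagAction hx.2 fun w hw hm =>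
      ⟨_, diagAction_sliceMap hq' ho hw hm⟩⟩
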